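/- Work in the hyperbolic plane $\mathbb H^2$ of curvature $-1$. Let $s>0$, let $E_0,E_1$ be two horocycles with a common ideal point $\mathcal O$ at distance $\ln 2$ from each other, $E_0$ bounding the smaller horoball, and let $\ell_0,\ell_1$ be two lines ending at $\mathcal O$ which cut an arc of length $s$ out of $E_0$, and hence an arc of length $2s$ out of $E_1$. The \emph{Böröczky pentagon} is the compact region bounded by these two lines and two horocycles. It has five edges: the arc $a$ on $E_0$, the two halves $b_1,b_2$ of the arc on $E_1$, and two straight edges ($c$-edges), each oriented from $a$ towards $b_1\cup b_2$; its five vertices are the end points of these edges. A \emph{tiling} is a collection of compact sets (tiles), each the closure of its interior, which cover the plane and whose interiors are pairwise disjoint. A \emph{B-tiling} is a tiling of $\mathbb H^2$ by congruent copies of the Böröczky pentagon which is edge-to-edge (any non-empty intersection of two different tiles is a common edge or a common vertex of both) and respects the orientations of the $c$-edges (if two tiles share a $c$-edge, the two orientations of it agree). The symmetry group of a tiling is the group of all isometries mapping the set of tiles onto itself. A tiling is \emph{crystallographic} if its symmetry group $G$ has a compact fundamental domain, i.e. if there is a compact set $F$ such that the sets $\varphi(F)$, $\varphi\in G$, cover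 the plane and have pairwise disjoint interiors for different $\varphi\in G$. \textbf{Theorem.} For every $s>0$, no B-tiling of $\mathbb H^2$ is crystallographic. -/

import Mathlib

open Set

namespace Boroczky

/-! ### Tilings, symmetry groups, crystallographic tilings -/

/-- A tiling of a space `X`: a collection of compact sets, each the closure of its interior, which
cover `X` and whose interiors are pairwise disjoint. -/
structure IsTiling {X : Type*} [TopologicalSpace X] (𝒯 : Set (Set X)) : Prop where
  isCompact : ∀ T ∈ 𝒯, IsCompact T
  closure_interior : ∀ T ∈ 𝒯, closure (interior T) = T
  covers : ⋃₀ 𝒯 = univ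
  disjoint : ∀ T ∈ 𝒯, ∀ T' ∈ 𝒯, T ≠ T' → Disjoint (interior T) (interior T')

/-- The symmetry group of a collection `𝒯` of sets: all isometries `φ` of `X` (bijective, orientation
preserving or not) with `φ(𝒯) = 𝒯`, that is `{φ(T) | T ∈ 𝒯} = 𝒯`. -/
def symmetryGroup {X : Type*} [MetricSpace X] (𝒯 : Set (Set X)) : Subgroup (X ≃ᵢ X) where
  carrier := {φ | (fun T : Set X => φ '' T) '' 𝒯 = 𝒯}
  one_mem' := by
    change (fun T : Set X => (fun x => x) '' T) '' 𝒯 = 𝒯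
    simp
  mul_mem' := by
    intro φ ψ hφ hψ
    change (fun T : Set X => (fun x => φ (ψ x)) '' T) '' 𝒯 = 𝒯
    have h : (fun T : Set X => (fun x => φ (ψ x)) '' T)
        = (fun T : Set X => φ '' T) ∘ (fun T : Set X => ψ '' T) := by
      funext T
      simp [Set.image_image]
    rw [h, Set.image_comp]
    exact (congrArg _ hψ).trans hφ
  inv_mem' := by
    intro φ hφ
    change (fun T : Set X => φ.symm '' T) '' 𝒯 = 𝒯
    have hφ' : (fun T : Set X => φ '' T) '' 𝒯 = 𝒯 := hφ
    conv_lhs => rw [← hφ']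
    rw [Set.image_image]
    simp [Set.image_image]

/-- `F` is a fundamental domain of the group `G` of isometries of `X`: it is closed, its
translates under `G` cover `X`, and translates under different elements of `G` do not overlap. -/
structure IsFundamentalDomain {X : Type*} [MetricSpace X] (G : Subgroup (X ≃ᵢ X)) (F : Set X) :
    Prop where
  isClosed : IsClosed F
  covers : ⋃ φ ∈ G, φ '' F = univ
  disjoint : ∀ φ ∈ G, ∀ ψ ∈ G, φ ≠ ψ → Disjoint (interior (φ '' F)) (interior (ψ '' F))

/-- A tiling is crystallographic if its symmetry group has a compact fundamental domain. -/
def IsCrystallographic {X : Type*} [MetricSpace X] (𝒯 : Set (Set X)) : Prop :=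
  ∃ F : Set X, IsCompact F ∧ IsFundamentalDomain (symmetryGroup 𝒯) F

/-! ### The Böröczky pentagon

The hyperbolic plane of curvature `-1` is the upper half-plane with its hyperbolic metric. Up to an
isometry the ideal point `𝒪` is `∞`, so that the horocycles centred at `𝒪` are the
horizontal lines and the hyperbolic lines ending at `𝒪` are the vertical half-lines.
The horocycles `im z = 2` and `im z = 1` are at distance `log 2`. Between the
vertical lines `re z = -s` and `re z = s` their arcs have lengths `s` and `2 * s`. -/

/-- The Böröczky pentagon whose three horocyclic edges have length `s`. -/
def pentagon (s : ℝ) : Set UpperHalfPlane :=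
  {z | -s ≤ z.re ∧ z.re ≤ s ∧ 1 ≤ z.im ∧ z.im ≤ 2}

/-- The short horocyclic edge `a`. -/
def edgeA (s : ℝ) : Set UpperHalfPlane := {z | -s ≤ z.re ∧ z.re ≤ s ∧ z.im = 2}

/-- The first half `b₁` of the long horocyclic arc. -/
def edgeB₁ (s : ℝ) : Set UpperHalfPlane := {z | -s ≤ z.re ∧ z.re ≤ 0 ∧ z.im = 1}

/-- The second half `b₂` of the long horocyclic arc. -/
def edgeB₂ (s : ℝ) : Set UpperHalfPlane := {z | 0 ≤ z.re ∧ z.re ≤ s ∧ z.im = 1}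

/-- One straight edge. -/
def edgeC₁ (s : ℝ) : Set UpperHalfPlane := {z | z.re = -s ∧ 1 ≤ z.im ∧ z.im ≤ 2}

/-- The other straight edge. -/
def edgeC₂ (s : ℝ) : Set UpperHalfPlane := {z | z.re = s ∧ 1 ≤ z.im ∧ z.im ≤ 2}

/-- The two straight edges (`c`-edges) of the pentagon. -/
def cEdges (s : ℝ) : Set (Set UpperHalfPlane) := {edgeC₁ s, edgeC₂ s}

/-- The five edges of the pentagon. -/
def edges (s : ℝ) : Set (Set UpperHalfPlane) :=
  {edgeA s, edgeB₁ s, edgeB₂ s, edgeC₁ s, edgeC₂ s}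

/-- The five vertices of the pentagon: the end points of its edges. -/
def vertices (s : ℝ) : Set UpperHalfPlane :=
  {z | (z.im = 2 ∧ (z.re = -s ∨ z.re = s)) ∨ (z.im = 1 ∧ (z.re = -s ∨ z.re = 0 ∨ z.re = s))}

/-! ### Copies of the pentagon

Edges and vertices are carried over to a copy `T` by an isometry `g` that takes the pentagon to
`T`. This does not depend on `g`: the only isometry other than the identity that maps the pentagon to
itself is the reflection in the imaginary axis, which fixes `a`, exchanges `b₁` and `b₂`, and exchanges
the two `c`-edges. -/

/-- `T` is congruent to the pentagon. -/
def IsCopy (s : ℝ) (T : Set UpperHalfPlane) : Prop :=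
  ∃ g : UpperHalfPlane ≃ᵢ UpperHalfPlane, T = g '' pentagon s

/-- `E` is an edge of the copy `T` of the pentagon. -/
def IsEdgeOf (s : ℝ) (E T : Set UpperHalfPlane) : Prop :=
  ∃ g : UpperHalfPlane ≃ᵢ UpperHalfPlane, T = g '' pentagon s ∧ ∃ e ∈ edges s, E = g '' e

/-- `p` is a vertex of the copy `T` of the pentagon. -/
def IsVertexOf (s : ℝ) (p : UpperHalfPlane) (T : Set UpperHalfPlane) : Prop :=
  ∃ g : UpperHalfPlane ≃ᵢ UpperHalfPlane, T = g '' pentagon s ∧ ∃ v ∈ vertices s, p = g v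

/-- `E` is a `c`-edge of the copy `T` of the pentagon, and `p` is its initial point when it is
oriented from the `a`-edge of `T` to the `b₁`- or `b₂`-edge, that is, the end point that it shares with
the `a`-edge. -/
def IsCEdgeOfFrom (s : ℝ) (E : Set UpperHalfPlane) (p : UpperHalfPlane)
    (T : Set UpperHalfPlane) : Prop :=
  ∃ g : UpperHalfPlane ≃ᵢ UpperHalfPlane, T = g '' pentagon s ∧
    ∃ e ∈ cEdges s, E = g '' e ∧ p ∈ g '' (e ∩ edgeA s)

/-! ### Böröczky tilings -/

/-- Any non-empty intersection of two different tiles is a common edge or a common vertex. -/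
def IsEdgeToEdge (s : ℝ) (𝒯 : Set (Set UpperHalfPlane)) : Prop :=
  ∀ T ∈ 𝒯, ∀ T' ∈ 𝒯, T ≠ T' → (T ∩ T').Nonempty →
    (IsEdgeOf s (T ∩ T') T ∧ IsEdgeOf s (T ∩ T') T') ∨
      ∃ p, T ∩ T' = {p} ∧ IsVertexOf s p T ∧ IsVertexOf s p T'

/-- Whenever two tiles have a `c`-edge in common, the two orientations of it agree. -/
def RespectsOrientation (s : ℝ) (𝒯 : Set (Set UpperHalfPlane)) : Prop :=
  ∀ T ∈ 𝒯, ∀ T' ∈ 𝒯, ∀ (E : Set UpperHalfPlane) (p p' : UpperHalfPlane),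
    IsCEdgeOfFrom s E p T → IsCEdgeOfFrom s E p' T' → p = p'

/-- Böröczky tilings (B-tilings): edge-to-edge tilings of the hyperbolic plane by copies of the
Böröczky pentagon which respect the orientations of the `c`-edges. -/
structure IsBTiling (s : ℝ) (𝒯 : Set (Set UpperHalfPlane)) : Prop where
  isTiling : IsTiling 𝒯
  isCopy : ∀ T ∈ 𝒯, IsCopy s T
  edgeToEdge : IsEdgeToEdge s 𝒯
  orientation : RespectsOrientation s 𝒯

end Boroczky

/-! Each tile points to an ideal point, the centre of its horocyclic edges, and tiles with a common
edge point to the same one: a horocyclic arc determines its centre, and so does a `c`-edge once it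
is oriented, since the orientation leads away from that centre. Hence all tiles share one ideal
point (`exists_isAff_of_mem`) and every symmetry fixes it (`isAff_of_mem_symmetryGroup`). With that
point at ∞, symmetries act by x + iy ↦ αx + β + i|α|y.

Such a group with discrete translations is never cocompact (`iUnion_image_ne_univ_of_isAff`). If
some element has |α| > 1, conjugation by it shrinks translations, so by discreteness there are none
but the identity; commutators are translations, so the group is abelian, fixes a second ideal point
x₀ and preserves the distance to the line from x₀ to ∞. Otherwise no element raises Im z. Either way
a function unbounded on the plane would be bounded on the translates of a compact set. -/

namespace Boroczky

open UpperHalfPlane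

/-! ### Isometries of the half-plane in coordinates -/

/-- The reflection of the half-plane in the imaginary axis. -/
def reflect (z : ℍ) : ℍ := ⟨⟨-z.re, z.im⟩, z.im_pos⟩

@[simp] lemma reflect_re (z : ℍ) : (reflect z).re = -z.re := rfl

@[simp] lemma reflect_im (z : ℍ) : (reflect z).im = z.im := rfl

/-- The point `x + y * I` of the half-plane. -/
def pt (x y : ℝ) (hy : 0 < y) : ℍ := ⟨⟨x, y⟩, hy⟩

@[simp] lemma pt_re (x y : ℝ) (hy : 0 < y) : (pt x y hy).re = x := rfl

@[simp] lemma pt_im (x y : ℝ) (hy : 0 < y) : (pt x y hy).im = y := rfl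

lemma cosh_dist_re_im (z w : ℍ) : Real.cosh (dist z w) =
    1 + ((z.re - w.re) ^ 2 + (z.im - w.im) ^ 2) / (2 * z.im * w.im) := by
  rw [UpperHalfPlane.cosh_dist, Complex.dist_eq, ← Complex.normSq_eq_norm_sq, Complex.normSq_apply]
  simp [pow_two]

lemma re_im_eq_of_dist_eq {z w z' w' : ℍ} (h : dist z w = dist z' w') :
    ((z.re - w.re) ^ 2 + (z.im - w.im) ^ 2) * (z'.im * w'.im) =
      ((z'.re - w'.re) ^ 2 + (z'.im - w'.im) ^ 2) * (z.im * w.im) := by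
  have h1 := congrArg Real.cosh h
  rw [cosh_dist_re_im, cosh_dist_re_im] at h1
  have a1 := z.im_pos
  have a2 := w.im_pos
  have a3 := z'.im_pos
  have a4 := w'.im_pos
  have h2 := add_left_cancel h1
  rw [div_eq_div_iff (by positivity) (by positivity)] at h2
  linarith

/-- A point is determined up to reflection by its distances to `I` and `2 * I`. -/
lemma eq_or_eq_reflect {z w : ℍ} (h1 : dist z (pt 0 1 one_pos) = dist w (pt 0 1 one_pos))
    (h2 : dist z (pt 0 2 two_pos) = dist w (pt 0 2 two_pos)) : z = w ∨ z = reflect w := by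
  have e1 := re_im_eq_of_dist_eq h1
  have e2 := re_im_eq_of_dist_eq h2
  simp only [pt_re, pt_im] at e1 e2
  have p1 := z.im_pos
  have p2 := w.im_pos
  have hy : z.im = w.im := by linarith
  rw [hy] at e1
  have hx : z.re ^ 2 = w.re ^ 2 := by
    have : (z.re ^ 2 - w.re ^ 2) * w.im = 0 := by linarith
    rcases mul_eq_zero.1 this with h | h <;> linarith
  rcases sq_eq_sq_iff_eq_or_eq_neg.1 hx with h | h
  · exact Or.inl (UpperHalfPlane.ext_re_im h hy)
  · exact Or.inr (UpperHalfPlane.ext_re_im h hy)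

/-- An isometry fixing `I` and `2 * I` is the identity or the reflection. -/
lemma isometry_eq_id_or_reflect {f : ℍ → ℍ} (hf : Isometry f)
    (h1 : f (pt 0 1 one_pos) = pt 0 1 one_pos) (h2 : f (pt 0 2 two_pos) = pt 0 2 two_pos) :
    (∀ z, f z = z) ∨ ∀ z, f z = reflect z := by
  have key (z : ℍ) : f z = z ∨ f z = reflect z := by
    apply eq_or_eq_reflect
    · conv_lhs => rw [← h1]
      exact hf.dist_eq _ _
    · conv_lhs => rw [← h2]
      exact hf.dist_eq _ _
  -- The alternative in `key` is uniform off the axis: if z is fixed and w reflected, equal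
  -- distances give (Re z - Re w)² = (Re z + Re w)², so one of the real parts vanishes.
  have hsep (z w : ℍ) (hz : z.re ≠ 0) (hw : w.re ≠ 0) (hfz : f z = z) (hfw : f w = reflect w) :
      False := by
    have e := re_im_eq_of_dist_eq (hf.dist_eq z w)
    rw [hfz, hfw] at e
    simp only [reflect_re, reflect_im] at e
    have p1 := z.im_pos
    have p2 := w.im_pos
    have : z.re * w.re * (z.im * w.im) = 0 := by linarith
    simp [hz, hw, p1.ne', p2.ne'] at this
  by_cases hp : f (pt 1 1 one_pos) = pt 1 1 one_pos
  · left
    intro z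
    rcases key z with h | h
    · exact h
    · by_cases hz : z.re = 0
      · rw [h]
        exact UpperHalfPlane.ext_re_im (by simp [hz]) rfl
      · exact (hsep _ _ (by simp) hz hp h).elim
  · right
    have hp' := (key (pt 1 1 one_pos)).resolve_left hp
    intro z
    rcases key z with h | h
    · by_cases hz : z.re = 0
      · rw [h]
        exact UpperHalfPlane.ext_re_im (by simp [hz]) rfl
      · exact (hsep _ _ hz (by simp) h hp').elim
    · exact h

lemma sl_smul_re_im (γ : Matrix.SpecialLinearGroup (Fin 2) ℝ) (z : ℍ) :
    (γ • z).im = z.im / ((γ 1 0 * z.re + γ 1 1) ^ 2 + γ 1 0 ^ 2 * z.im ^ 2) ∧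
    (γ • z).re = (γ 0 0 * γ 1 0 * (z.re ^ 2 + z.im ^ 2) +
      (γ 0 0 * γ 1 1 + γ 0 1 * γ 1 0) * z.re + γ 0 1 * γ 1 1) /
        ((γ 1 0 * z.re + γ 1 1) ^ 2 + γ 1 0 ^ 2 * z.im ^ 2) := by
  have hd : γ 0 0 * γ 1 1 - γ 0 1 * γ 1 0 = 1 := by
    rw [← Matrix.det_fin_two, γ.2]
  have h := UpperHalfPlane.coe_specialLinearGroup_apply γ z
  have hN : Complex.normSq ((γ 1 0 : ℂ) * z + γ 1 1) =
      (γ 1 0 * z.re + γ 1 1) ^ 2 + γ 1 0 ^ 2 * z.im ^ 2 := by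
    simp [Complex.normSq_apply]
    ring
  constructor
  · rw [← UpperHalfPlane.coe_im, h]
    simp only [Algebra.algebraMap_self, RingHom.id_apply]
    rw [Complex.div_im, hN, ← sub_div]
    congr 1
    simp
    linear_combination z.im * hd
  · rw [← UpperHalfPlane.coe_re, h]
    simp only [Algebra.algebraMap_self, RingHom.id_apply]
    rw [Complex.div_re, hN, ← add_div]
    congr 1
    simp
    ring

/-- Every point can be rotated about `I` onto the imaginary axis. -/
lemma exists_rotation_re_eq_zero (w : ℍ) : ∃ ρ : Matrix.SpecialLinearGroup (Fin 2) ℝ,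
    ρ • (pt 0 1 one_pos) = pt 0 1 one_pos ∧ (ρ • w).re = 0 := by
  -- The numerator of Re (ρ • w) for the rotation matrix ρ below; t = π/2 gives w ↦ -1/w, which
  -- reverses its sign.
  let F : ℝ → ℝ := fun t => -(Real.cos t * Real.sin t) * (w.re ^ 2 + w.im ^ 2) +
    (Real.cos t * Real.cos t - Real.sin t * Real.sin t) * w.re + Real.sin t * Real.cos t
  have hF : Continuous F := by fun_prop
  have h0 : F 0 = w.re := by simp [F]
  have h1 : F (Real.pi / 2) = -w.re := by simp [F]
  have hz : ∃ t, F t = 0 := by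
    rcases le_total 0 w.re with h | h
    · obtain ⟨t, -, ht⟩ := intermediate_value_uIcc (a := 0) (b := Real.pi / 2) hF.continuousOn
        (show (0 : ℝ) ∈ uIcc (F 0) (F (Real.pi / 2)) by
          rw [h0, h1, mem_uIcc]; right; constructor <;> linarith)
      exact ⟨t, ht⟩
    · obtain ⟨t, -, ht⟩ := intermediate_value_uIcc (a := 0) (b := Real.pi / 2) hF.continuousOn
        (show (0 : ℝ) ∈ uIcc (F 0) (F (Real.pi / 2)) by
          rw [h0, h1, mem_uIcc]; left; constructor <;> linarith)
      exact ⟨t, ht⟩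
  obtain ⟨t, ht⟩ := hz
  have hcs := Real.sin_sq_add_cos_sq t
  let ρ : Matrix.SpecialLinearGroup (Fin 2) ℝ :=
    ⟨!![Real.cos t, Real.sin t; -Real.sin t, Real.cos t], by
      rw [Matrix.det_fin_two_of]; linarith⟩
  have e00 : ρ 0 0 = Real.cos t := rfl
  have e01 : ρ 0 1 = Real.sin t := rfl
  have e10 : ρ 1 0 = -Real.sin t := rfl
  have e11 : ρ 1 1 = Real.cos t := rfl
  refine ⟨ρ, ?_, ?_⟩
  · obtain ⟨hi, hr⟩ := sl_smul_re_im ρ (pt 0 1 one_pos)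
    rw [e10, e11] at hi
    rw [e00, e01, e10, e11] at hr
    apply UpperHalfPlane.ext_re_im
    · rw [hr, pt_re, pt_im, div_eq_zero_iff]
      left; ring
    · rw [hi, pt_re, pt_im]
      rw [div_eq_one_iff_eq] <;> nlinarith
  · rw [(sl_smul_re_im ρ w).2, e00, e01, e10, e11, div_eq_zero_iff]
    left
    simp only [F] at ht
    linarith

/-- Two points at distance `log 2` can be moved to `I` and `2 * I`. -/
lemma exists_smul_eq_and_smul_eq (z w : ℍ)
    (h : dist z w = dist (pt 0 1 one_pos) (pt 0 2 two_pos)) :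
    ∃ γ : Matrix.SpecialLinearGroup (Fin 2) ℝ,
      γ • z = pt 0 1 one_pos ∧ γ • w = pt 0 2 two_pos := by
  obtain ⟨γ, hγ⟩ := MulAction.exists_smul_eq (Matrix.SpecialLinearGroup (Fin 2) ℝ) z
    (pt 0 1 one_pos)
  obtain ⟨ρ, hρ, hw⟩ := exists_rotation_re_eq_zero (γ • w)
  have hd : dist (pt 0 1 one_pos) (ρ • γ • w) = dist (pt 0 1 one_pos) (pt 0 2 two_pos) := by
    rw [← h, ← hρ, ← hγ, dist_smul, dist_smul]
  have e := re_im_eq_of_dist_eq hd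
  simp only [pt_re, pt_im, hw] at e
  have hf : ((ρ • γ • w).im - 2) * (2 * (ρ • γ • w).im - 1) = 0 := by linarith
  rcases mul_eq_zero.1 hf with hf | hf
  · refine ⟨ρ * γ, by rw [mul_smul, hγ, hρ], ?_⟩
    rw [mul_smul]
    exact UpperHalfPlane.ext_re_im hw (by simp; linarith)
  -- The second point has landed on I/2; the half-turn z ↦ -1/z about I takes it to 2I.
  · let S : Matrix.SpecialLinearGroup (Fin 2) ℝ :=
      ⟨!![0, -1; 1, 0], by rw [Matrix.det_fin_two_of]; norm_num⟩
    have e00 : S 0 0 = 0 := rfl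
    have e01 : S 0 1 = -1 := rfl
    have e10 : S 1 0 = 1 := rfl
    have e11 : S 1 1 = 0 := rfl
    have hi : (ρ • γ • w).im = 1 / 2 := by linarith
    refine ⟨S * (ρ * γ), ?_, ?_⟩
    · rw [mul_smul, mul_smul, hγ, hρ]
      obtain ⟨hi, hr⟩ := sl_smul_re_im S (pt 0 1 one_pos)
      apply UpperHalfPlane.ext_re_im
      · rw [hr, e00, e01, e10, e11]; simp
      · rw [hi, e10, e11]; simp
    · rw [mul_smul, mul_smul]
      obtain ⟨hi', hr⟩ := sl_smul_re_im S (ρ • γ • w)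
      apply UpperHalfPlane.ext_re_im
      · rw [hr, e00, e01, e10, e11, hw]; simp
      · rw [hi', e10, e11, hw, hi, pt_im]; norm_num

/-- Every isometry of the hyperbolic plane is a Möbius transformation, possibly followed by the
reflection in the imaginary axis. -/
theorem exists_coeff_of_isometry (g : ℍ ≃ᵢ ℍ) : ∃ a b c d ε : ℝ, (ε = 1 ∨ ε = -1) ∧
    a * d - b * c = 1 ∧ ∀ z : ℍ, (g z).im = z.im / ((c * z.re + d) ^ 2 + c ^ 2 * z.im ^ 2) ∧
    (g z).re = ε * ((a * c * (z.re ^ 2 + z.im ^ 2) + (a * d + b * c) * z.re + b * d) /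
      ((c * z.re + d) ^ 2 + c ^ 2 * z.im ^ 2)) := by
  obtain ⟨γ, h1, h2⟩ := exists_smul_eq_and_smul_eq (g (pt 0 1 one_pos)) (g (pt 0 2 two_pos))
    (g.isometry.dist_eq _ _)
  have hdet : γ⁻¹ 0 0 * γ⁻¹ 1 1 - γ⁻¹ 0 1 * γ⁻¹ 1 0 = 1 := by
    rw [← Matrix.det_fin_two, γ⁻¹.2]
  rcases isometry_eq_id_or_reflect ((isometry_smul ℍ γ).comp g.isometry) h1 h2 with h | h
  · refine ⟨_, _, _, _, 1, Or.inl rfl, hdet, fun z => ?_⟩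
    have hz : g z = γ⁻¹ • z := by rw [eq_inv_smul_iff]; exact h z
    rw [hz, one_mul]
    exact sl_smul_re_im γ⁻¹ z
  -- Moving the reflection to the left of γ⁻¹ conjugates the matrix by diag(-1, 1); the overall sign
  -- is immaterial.
  · refine ⟨-γ⁻¹ 0 0, γ⁻¹ 0 1, γ⁻¹ 1 0, -γ⁻¹ 1 1, -1, Or.inr rfl, by linarith, fun z => ?_⟩
    have hz : g z = γ⁻¹ • reflect z := by rw [eq_inv_smul_iff]; exact h z
    obtain ⟨hi, hr⟩ := sl_smul_re_im γ⁻¹ (reflect z)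
    rw [hz, hi, hr, reflect_re, reflect_im]
    constructor
    · congr 1; ring
    · rw [← mul_div_assoc]; congr 1 <;> ring

/-! ### Isometries fixing ∞ -/

/-- Isometries of the half-plane that fix the ideal point `∞`. -/
def IsAff (g : ℍ ≃ᵢ ℍ) : Prop :=
  ∃ α β : ℝ, α ≠ 0 ∧ ∀ z : ℍ, (g z).re = α * z.re + β ∧ (g z).im = |α| * z.im

lemma IsAff.mul {g h : ℍ ≃ᵢ ℍ} (hg : IsAff g) (hh : IsAff h) : IsAff (g * h) := by
  obtain ⟨α, β, h0, H⟩ := hg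
  obtain ⟨α', β', h0', H'⟩ := hh
  refine ⟨α * α', α * β' + β, mul_ne_zero h0 h0', fun z => ?_⟩
  rw [IsometryEquiv.mul_apply, (H _).1, (H _).2, (H' z).1, (H' z).2, abs_mul]
  constructor <;> ring

/-- On a horizontal line, a condition Im g = k or Re g = k becomes quadratic in x once the
denominator is cleared. -/
lemma coeff_eq_zero_of_infinite {p q r : ℝ} {S : Set ℝ} (hS : S.Infinite)
    (h : ∀ x ∈ S, p * x ^ 2 + q * x + r = 0) : p = 0 ∧ q = 0 ∧ r = 0 := by
  have h0 : (Polynomial.C p * Polynomial.X ^ 2 + Polynomial.C q * Polynomial.X + Polynomial.C r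
      : Polynomial ℝ) = 0 := by
    apply Polynomial.eq_zero_of_infinite_isRoot
    refine hS.mono fun x hx => ?_
    simpa using h x hx
  refine ⟨?_, ?_, ?_⟩
  · simpa [Polynomial.coeff_X, Polynomial.coeff_C] using congrArg (fun P => Polynomial.coeff P 2) h0
  · simpa [Polynomial.coeff_X, Polynomial.coeff_C] using congrArg (fun P => Polynomial.coeff P 1) h0
  · simpa [Polynomial.coeff_X, Polynomial.coeff_C] using congrArg (fun P => Polynomial.coeff P 0) h0

lemma coeff_denom_pos {a b c d : ℝ} (h : a * d - b * c = 1) (z : ℍ) :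
    0 < (c * z.re + d) ^ 2 + c ^ 2 * z.im ^ 2 := by
  have hy := z.im_pos
  rcases eq_or_ne c 0 with rfl | hc
  · have : d ≠ 0 := by rintro rfl; simp at h
    simp only [zero_mul, zero_add]
    positivity
  · positivity

lemma isAff_of_coeff {g : ℍ ≃ᵢ ℍ} {a b c d ε : ℝ} (hε : ε = 1 ∨ ε = -1)
    (hdet : a * d - b * c = 1)
    (H : ∀ z : ℍ, (g z).im = z.im / ((c * z.re + d) ^ 2 + c ^ 2 * z.im ^ 2) ∧
      (g z).re = ε * ((a * c * (z.re ^ 2 + z.im ^ 2) + (a * d + b * c) * z.re + b * d) /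
        ((c * z.re + d) ^ 2 + c ^ 2 * z.im ^ 2)))
    (hc : c = 0) : IsAff g := by
  subst hc
  simp only [mul_zero, sub_zero, add_zero, zero_mul, zero_add, ne_eq, OfNat.ofNat_ne_zero,
    not_false_eq_true, zero_pow] at hdet H
  have hd : d ≠ 0 := by rintro rfl; simp at hdet
  have hε' : |ε| = 1 := by rcases hε with rfl | rfl <;> simp
  have hε0 : ε ≠ 0 := by rcases hε with rfl | rfl <;> simp
  refine ⟨ε / d ^ 2, ε * b / d, by positivity, fun z => ?_⟩
  rw [(H z).1, (H z).2, abs_div, hε', abs_of_pos (by positivity : 0 < d ^ 2), hdet]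
  constructor <;> field_simp

/-- An isometry taking infinitely many points of a horizontal line to a horizontal line
fixes `∞`. -/
lemma isAff_of_im_eq {g : ℍ ≃ᵢ ℍ} {y k : ℝ} (hy : 0 < y) {S : Set ℝ} (hS : S.Infinite)
    (h : ∀ x ∈ S, (g (pt x y hy)).im = k) : IsAff g := by
  obtain ⟨a, b, c, d, ε, hε, hdet, H⟩ := exists_coeff_of_isometry g
  have hk : k ≠ 0 := by
    obtain ⟨x, hx⟩ := hS.nonempty
    rw [← h x hx]
    exact (g _).im_pos.ne'
  have hc := (coeff_eq_zero_of_infinite (p := k * c ^ 2) (q := 2 * k * c * d)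
    (r := k * (d ^ 2 + c ^ 2 * y ^ 2) - y) hS fun x hx => by
      have h1 := h x hx
      have := coeff_denom_pos hdet (pt x y hy)
      rw [(H _).1, div_eq_iff this.ne'] at h1
      simp only [pt_re, pt_im] at h1
      linarith).1
  exact isAff_of_coeff hε hdet H (by simpa [hk] using hc)

/-- An isometry does not take infinitely many points of a horizontal line to a vertical line. -/
lemma not_re_eq {g : ℍ ≃ᵢ ℍ} {y k : ℝ} (hy : 0 < y) {S : Set ℝ} (hS : S.Infinite)
    (h : ∀ x ∈ S, (g (pt x y hy)).re = k) : False := by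
  obtain ⟨a, b, c, d, ε, hε, hdet, H⟩ := exists_coeff_of_isometry g
  have hεε : ε * ε = 1 := by rcases hε with rfl | rfl <;> norm_num
  obtain ⟨h1, h2, h3⟩ := coeff_eq_zero_of_infinite (p := a * c - ε * k * c ^ 2)
    (q := a * d + b * c - 2 * (ε * k) * c * d)
    (r := a * c * y ^ 2 + b * d - ε * k * (d ^ 2 + c ^ 2 * y ^ 2)) hS fun x hx => by
      have h1 := h x hx
      have := coeff_denom_pos hdet (pt x y hy)
      rw [(H _).2, ← mul_div_assoc, div_eq_iff this.ne'] at h1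
      simp only [pt_re, pt_im] at h1
      have h2 := congrArg (ε * ·) h1
      simp only [← mul_assoc, hεε] at h2
      linarith
  rcases eq_or_ne c 0 with rfl | hc
  -- If c = 0, the linear coefficient ad vanishes; otherwise the rows (a, b) and (c, d) are
  -- proportional. Both contradict ad - bc = 1.
  · linarith
  · have ha : a = ε * k * c := by
      apply mul_right_cancel₀ hc
      linarith
    have hb : b = ε * k * d := by
      apply mul_right_cancel₀ hc
      rw [ha] at h2
      linarith
    rw [ha, hb] at hdet
    linarith

/-! ### The ideal point of a tile and of its neighbours -/

lemma pentagon_open_subset_interior (s : ℝ) :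
    {z : ℍ | -s < z.re ∧ z.re < s ∧ 1 < z.im ∧ z.im < 2} ⊆ interior (pentagon s) := by
  apply interior_maximal
  · rintro z ⟨h1, h2, h3, h4⟩
    exact ⟨h1.le, h2.le, h3.le, h4.le⟩
  · have hr := UpperHalfPlane.continuous_re
    have hi := UpperHalfPlane.continuous_im
    exact (isOpen_lt continuous_const hr).inter ((isOpen_lt hr continuous_const).inter
      ((isOpen_lt continuous_const hi).inter (isOpen_lt hi continuous_const)))

/-- Since Im is an open map, it cannot attain its bound 2 in the interior; so the `a`-edge lies on
the boundary. -/
lemma im_lt_of_mem_interior_pentagon {s : ℝ} {z : ℍ} (hz : z ∈ interior (pentagon s)) :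
    z.im < 2 := by
  have h : UpperHalfPlane.im '' interior (pentagon s) ⊆ interior (Iic 2) := by
    apply interior_maximal
    · rintro _ ⟨w, hw, rfl⟩
      exact (interior_subset hw).2.2.2
    · exact UpperHalfPlane.isOpenMap_im _ isOpen_interior
  rw [interior_Iic] at h
  exact h ⟨z, hz, rfl⟩

lemma image_interior_eq (h : ℍ ≃ᵢ ℍ) (A : Set ℍ) : h '' interior A = interior (h '' A) :=
  h.toHomeomorph.image_interior A

/-- The ideal point `∞` is determined by the pentagon. -/
lemma isAff_of_image_pentagon {s : ℝ} (hs : 0 < s) {h : ℍ ≃ᵢ ℍ}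
    (hP : h '' pentagon s = pentagon s) : IsAff h := by
  -- The image of the `a`-edge stays on the boundary, which lies on two horizontal and two vertical
  -- lines; one of them receives infinitely many of its points.
  have hsub : Icc (-s) s ⊆ ({x | (h (pt x 2 two_pos)).im = 1} ∪ {x | (h (pt x 2 two_pos)).im = 2}) ∪
      ({x | (h (pt x 2 two_pos)).re = -s} ∪ {x | (h (pt x 2 two_pos)).re = s}) := by
    rintro x ⟨hx1, hx2⟩
    have hmem : h (pt x 2 two_pos) ∈ pentagon s := by
      rw [← hP]
      exact mem_image_of_mem _ ⟨hx1, hx2, by simp, le_rfl⟩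
    have hnot : h (pt x 2 two_pos) ∉ interior (pentagon s) := by
      rw [← hP, ← image_interior_eq, h.injective.mem_set_image]
      intro hc
      exact lt_irrefl _ (im_lt_of_mem_interior_pentagon hc)
    obtain ⟨h1, h2, h3, h4⟩ := hmem
    by_contra hcon
    simp only [mem_union, mem_ofPred_eq, not_or] at hcon
    obtain ⟨⟨n1, n2⟩, n3, n4⟩ := hcon
    exact hnot (pentagon_open_subset_interior s ⟨lt_of_le_of_ne h1 (Ne.symm n3),
      lt_of_le_of_ne h2 n4, lt_of_le_of_ne h3 (Ne.symm n1), lt_of_le_of_ne h4 n2⟩)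
  have hinf := (Icc_infinite (show -s < s by linarith)).mono hsub
  simp only [infinite_union] at hinf
  rcases hinf with (hi | hi) | hi | hi
  · exact isAff_of_im_eq two_pos hi fun x hx => hx
  · exact isAff_of_im_eq two_pos hi fun x hx => hx
  · exact (not_re_eq two_pos hi fun x hx => hx).elim
  · exact (not_re_eq two_pos hi fun x hx => hx).elim

/-- The ideal point belongs to the tile and not to the isometry chosen to present it. -/
lemma isAff_of_image_eq {s : ℝ} (hs : 0 < s) {g g' : ℍ ≃ᵢ ℍ}
    (h : g '' pentagon s = g' '' pentagon s) : IsAff (g⁻¹ * g') := by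
  apply isAff_of_image_pentagon hs
  rw [IsometryEquiv.coe_mul, image_comp, ← h, ← image_comp, ← IsometryEquiv.coe_mul]
  simp

lemma edge_cases {s : ℝ} (hs : 0 < s) {e : Set ℍ} (he : e ∈ edges s) : e ∈ cEdges s ∨
    ∃ (y : ℝ) (hy : 0 < y) (S : Set ℝ), S.Infinite ∧ (∀ x ∈ S, pt x y hy ∈ e) ∧
      ∀ z ∈ e, z.im = y := by
  rcases he with rfl | rfl | rfl | he
  · exact Or.inr ⟨2, two_pos, Icc (-s) s, Icc_infinite (by linarith),
      fun x hx => ⟨hx.1, hx.2, rfl⟩, fun z hz => hz.2.2⟩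
  · exact Or.inr ⟨1, one_pos, Icc (-s) 0, Icc_infinite (by linarith),
      fun x hx => ⟨hx.1, hx.2, rfl⟩, fun z hz => hz.2.2⟩
  · exact Or.inr ⟨1, one_pos, Icc 0 s, Icc_infinite (by linarith),
      fun x hx => ⟨hx.1, hx.2, rfl⟩, fun z hz => hz.2.2⟩
  · exact Or.inl he

lemma cEdge_cases {s : ℝ} (hs : 0 < s) {e : Set ℍ} (he : e ∈ cEdges s) :
    ∃ x : ℝ, e = {z : ℍ | z.re = x ∧ 1 ≤ z.im ∧ z.im ≤ 2} ∧
      pt x 2 two_pos ∈ e ∩ edgeA s := by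
  rcases he with rfl | rfl
  · exact ⟨-s, rfl, ⟨rfl, by simp, le_rfl⟩, le_rfl, by simp; linarith, rfl⟩
  · exact ⟨s, rfl, ⟨rfl, by simp, le_rfl⟩, by simp; linarith, le_rfl, rfl⟩

/-- An isometry matching two edges other than a pair of `c`-edges fixes `∞`. -/
lemma isAff_of_image_edge {s : ℝ} (hs : 0 < s) {h : ℍ ≃ᵢ ℍ} {e e' : Set ℍ} (he : e ∈ edges s)
    (he' : e' ∈ edges s) (hc : ¬ (e ∈ cEdges s ∧ e' ∈ cEdges s)) (hh : h '' e' = e) :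
    IsAff h := by
  rcases edge_cases hs he' with hc' | ⟨y, hy, S, hS, hS', -⟩
  · rcases edge_cases hs he with hc'' | ⟨y, hy, S, hS, hS', -⟩
    · exact (hc ⟨hc'', hc'⟩).elim
    · obtain ⟨x, rfl, -⟩ := cEdge_cases hs hc'
      refine (not_re_eq (g := h⁻¹) (k := x) hy hS fun x' hx' => ?_).elim
      obtain ⟨z, hz, hzx⟩ := hh.symm ▸ hS' x' hx'
      rw [← hzx, IsometryEquiv.inv_apply_self]
      exact hz.1
  · rcases edge_cases hs he with hc' | ⟨y', hy', S', -, -, hS''⟩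
    · obtain ⟨x, rfl, -⟩ := cEdge_cases hs hc'
      refine (not_re_eq (g := h) (k := x) hy hS fun x' hx' => ?_).elim
      exact (hh.subset (mem_image_of_mem h (hS' x' hx'))).1
    · exact isAff_of_im_eq (k := y') hy hS fun x hx =>
        hS'' _ (hh.subset (mem_image_of_mem h (hS' x hx)))

/-- An isometry matching two `c`-edges with their orientations fixes `∞`. -/
lemma isAff_of_image_vertical {h : ℍ ≃ᵢ ℍ} {x x' : ℝ}
    (h2 : h (pt x' 2 two_pos) = pt x 2 two_pos)
    (h1 : h (pt x' 1 one_pos) ∈ {z : ℍ | z.re = x ∧ 1 ≤ z.im ∧ z.im ≤ 2}) : IsAff h := by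
  obtain ⟨hx, hy1, hy2⟩ := h1
  have e := re_im_eq_of_dist_eq (h.isometry.dist_eq (pt x' 1 one_pos) (pt x' 2 two_pos))
  rw [h2] at e
  simp only [pt_re, pt_im, hx] at e
  -- The distance equation reads (y - 2)² = y, with roots 1 and 4.
  have hy : (h (pt x' 1 one_pos)).im = 1 := by nlinarith
  obtain ⟨a, b, c, d, ε, hε, hdet, H⟩ := exists_coeff_of_isometry h
  have n1 := (H (pt x' 1 one_pos)).1
  have n2 := (H (pt x' 2 two_pos)).1
  rw [hy, eq_comm, div_eq_iff (coeff_denom_pos hdet _).ne'] at n1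
  rw [h2, eq_comm, div_eq_iff (coeff_denom_pos hdet _).ne'] at n2
  simp only [pt_re, pt_im] at n1 n2
  -- Both heights are preserved, so (cx' + d)² + c²y² = 1 for y = 1 and for y = 2.
  have hc : c ^ 2 = 0 := by linarith
  exact isAff_of_coeff hε hdet H (by simpa using hc)

/-- Two tiles with a common edge have the same ideal point. -/
lemma isAff_of_common_edge {s : ℝ} (hs : 0 < s) {𝒯 : Set (Set ℍ)} (hO : RespectsOrientation s 𝒯)
    {g g' : ℍ ≃ᵢ ℍ} (hT : g '' pentagon s ∈ 𝒯) (hT' : g' '' pentagon s ∈ 𝒯) {E : Set ℍ}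
    (hE : IsEdgeOf s E (g '' pentagon s)) (hE' : IsEdgeOf s E (g' '' pentagon s)) :
    IsAff (g⁻¹ * g') := by
  obtain ⟨g₁, hg₁, e, he, rfl⟩ := hE
  obtain ⟨g₂, hg₂, e', he', hee⟩ := hE'
  have hh : (g₁⁻¹ * g₂) '' e' = e := by
    rw [IsometryEquiv.coe_mul, image_comp, ← hee, ← image_comp, ← IsometryEquiv.coe_mul]
    simp
  have key : IsAff (g₁⁻¹ * g₂) := by
    by_cases hc : e ∈ cEdges s ∧ e' ∈ cEdges s
    · obtain ⟨x, hx, hx2⟩ := cEdge_cases hs hc.1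
      obtain ⟨x', hx', hx2'⟩ := cEdge_cases hs hc.2
      -- Equal initial points exclude the half-turn about the midpoint of the edge, which would move
      -- the ideal point.
      have hp := hO _ hT _ hT' (g₁ '' e) (g₁ (pt x 2 two_pos)) (g₂ (pt x' 2 two_pos))
        ⟨g₁, hg₁, e, hc.1, rfl, mem_image_of_mem _ hx2⟩
        ⟨g₂, hg₂, e', hc.2, hee, mem_image_of_mem _ hx2'⟩
      refine isAff_of_image_vertical (x := x) (x' := x') ?_ ?_
      · rw [IsometryEquiv.mul_apply, ← hp, IsometryEquiv.inv_apply_self]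
      · rw [← hx]
        refine hh.subset (mem_image_of_mem _ ?_)
        rw [hx']
        exact ⟨rfl, le_rfl, by simp⟩
    · exact isAff_of_image_edge hs he he' hc hh
  have := ((isAff_of_image_eq hs hg₁).mul key).mul (isAff_of_image_eq hs hg₂.symm)
  simpa [mul_assoc] using this

/-! ### Local finiteness and the common ideal point -/

/-- In a proper space, only finitely many indices of an `r`-separated family have their points in a
given closed ball. -/
lemma finite_of_separated {X ι : Type*} [MetricSpace X] [ProperSpace X] {c : ι → X} {r : ℝ}
    (hr : 0 < r) (hsep : ∀ i j, i ≠ j → r ≤ dist (c i) (c j)) (x : X) (R : ℝ) :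
    {i | c i ∈ Metric.closedBall x R}.Finite := by
  by_contra hinf
  let u := Set.Infinite.natEmbedding _ hinf
  obtain ⟨a, -, φ, hφ, hlim⟩ := (isCompact_closedBall x R).tendsto_subseq
    (x := fun n => c (u n)) fun n => (u n).2
  obtain ⟨N, hN⟩ := Metric.cauchySeq_iff.1 hlim.cauchySeq r hr
  have h1 := hN N le_rfl (N + 1) (Nat.le_succ N)
  refine absurd h1 (not_lt.2 (hsep _ _ fun h => ?_))
  have h2 := hφ.injective (u.injective (Subtype.ext h))
  omega

lemma isCompact_pentagon_of_isBTiling {s : ℝ} {𝒯 : Set (Set ℍ)} (h : IsBTiling s 𝒯) :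
    IsCompact (pentagon s) := by
  obtain ⟨T, hT, -⟩ := h.isTiling.covers.symm.subset (mem_univ I)
  obtain ⟨g, rfl⟩ := h.isCopy T hT
  have h1 := (h.isTiling.isCompact _ hT).image g.symm.continuous
  rwa [← image_comp, g.symm_comp_self, image_id] at h1

lemma center_mem_interior {s : ℝ} (hs : 0 < s) :
    pt 0 (3 / 2) (by norm_num) ∈ interior (pentagon s) :=
  pentagon_open_subset_interior s ⟨by simpa, by simpa, by norm_num, by norm_num⟩

/-- The tiles form a locally finite family. -/
lemma locallyFinite_tiles {s : ℝ} (hs : 0 < s) {𝒯 : Set (Set ℍ)} (h : IsBTiling s 𝒯) :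
    LocallyFinite fun T : 𝒯 => (T : Set ℍ) := by
  have hcopy (T : 𝒯) := h.isCopy T T.2
  choose g hg using hcopy
  obtain ⟨r, hr, hball⟩ := Metric.isOpen_iff.1 isOpen_interior _ (center_mem_interior hs)
  obtain ⟨R, hR⟩ := (isCompact_pentagon_of_isBTiling h).isBounded.subset_closedBall
    (pt 0 (3 / 2) (by norm_num))
  set c : ℍ := pt 0 (3 / 2) (by norm_num)
  -- Each tile's interior contains the ball of radius r about its centre, so a centre closer than r
  -- would lie in two disjoint interiors.
  have hsep (T T' : 𝒯) (hne : T ≠ T') : r ≤ dist (g T c) (g T' c) := by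
    by_contra! hlt
    have hd := h.isTiling.disjoint T T.2 T' T'.2 fun hc => hne (Subtype.ext hc)
    rw [hg T, hg T', ← image_interior_eq, ← image_interior_eq] at hd
    refine disjoint_left.1 hd (mem_image_of_mem _ (center_mem_interior hs))
      ⟨(g T').symm (g T c), hball ?_, (g T').apply_symm_apply _⟩
    rw [Metric.mem_ball, ← (g T').dist_eq]
    rw [(g T').apply_symm_apply]
    exact hlt
  intro x
  refine ⟨Metric.ball x 1, Metric.ball_mem_nhds x one_pos,
    (finite_of_separated hr hsep x (R + 1)).subset ?_⟩
  rintro T ⟨y, hyT, hyx⟩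
  obtain ⟨p, hp, rfl⟩ := (hg T).subset hyT
  have h1 := hR hp
  rw [Metric.mem_closedBall, ← (g T).dist_eq, dist_comm] at h1
  rw [Metric.mem_ball] at hyx
  exact (dist_triangle _ _ _).trans (by linarith)

lemma countable_tiles {s : ℝ} (hs : 0 < s) {𝒯 : Set (Set ℍ)} (h : IsBTiling s 𝒯) :
    𝒯.Countable := by
  refine PairwiseDisjoint.countable_of_isOpen (s := fun T => interior T)
    (fun T hT T' hT' hne => h.isTiling.disjoint T hT T' hT' hne)
    (fun T _ => isOpen_interior) fun T hT => ?_
  obtain ⟨g, rfl⟩ := h.isCopy T hT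
  rw [← image_interior_eq]
  exact ⟨_, mem_image_of_mem _ (center_mem_interior hs)⟩

/-- Ensures that a tile keeps some points when a countable set is removed. -/
lemma not_countable_tile {s : ℝ} (hs : 0 < s) (g : ℍ ≃ᵢ ℍ) : ¬ (g '' pentagon s).Countable := by
  intro hc
  have h1 := hc.preimage_of_injOn (f := fun x : ℝ => g (pt x 1 one_pos)) (by
    intro x _ y _ hxy
    exact congrArg UpperHalfPlane.re (g.injective hxy))
  refine not_lt.2 (Cardinal.le_aleph0_iff_set_countable.2 (h1.mono (s₁ := Icc (-s) s) ?_)) ?_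
  · intro x hx
    exact mem_image_of_mem _ ⟨hx.1, hx.2, le_rfl, by simp⟩
  · rw [Cardinal.mk_Icc_real (by linarith)]
    exact Cardinal.aleph0_lt_continuum

/-- The complement of a countable set in the hyperbolic plane is connected. -/
lemma isPreconnected_compl_of_countable {D : Set ℍ} (hD : D.Countable) : IsPreconnected Dᶜ := by
  let φ : ℂ → ℍ := fun z => ⟨⟨z.re, Real.exp z.im⟩, Real.exp_pos _⟩
  have hre (z : ℂ) : (φ z).re = z.re := rfl
  have him (z : ℂ) : (φ z).im = Real.exp z.im := rfl
  have hφ : Continuous φ := by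
    apply Continuous.upperHalfPlaneMk
    exact Complex.equivRealProdCLM.symm.continuous.comp
      (Complex.continuous_re.prodMk (Real.continuous_exp.comp Complex.continuous_im))
  have hinj : Function.Injective φ := by
    intro z w hzw
    apply Complex.ext
    · rw [← hre, hzw, hre]
    · apply Real.exp_injective
      rw [← him, hzw, him]
  have hsurj : Function.Surjective φ := fun w =>
    ⟨⟨w.re, Real.log w.im⟩, UpperHalfPlane.ext_re_im rfl (Real.exp_log w.im_pos)⟩
  have h1 := (hD.preimage_of_injOn hinj.injOn).isConnected_compl_of_one_lt_rank
    (E := ℂ) (by simp)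
  have h2 := h1.isPreconnected.image φ hφ.continuousOn
  rwa [← preimage_compl, image_preimage_eq _ hsurj] at h2

/-- All tiles have the same ideal point. -/
theorem exists_isAff_of_mem {s : ℝ} (hs : 0 < s) {𝒯 : Set (Set ℍ)} (h : IsBTiling s 𝒯)
    {g₀ : ℍ ≃ᵢ ℍ} (h₀ : g₀ '' pentagon s ∈ 𝒯) {T : Set ℍ} (hT : T ∈ 𝒯) :
    ∃ g : ℍ ≃ᵢ ℍ, T = g '' pentagon s ∧ IsAff (g₀⁻¹ * g) := by
  by_contra hbad
  let good : Set ℍ → Prop := fun T => ∃ g : ℍ ≃ᵢ ℍ, T = g '' pentagon s ∧ IsAff (g₀⁻¹ * g)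
  -- Off the countable set D, different tiles that meet share an edge. The good and the bad tiles
  -- have closed unions covering the connected set Dᶜ, so if both kinds occur, a good and a bad tile
  -- meet there.
  let D : Set ℍ := ⋃ T ∈ 𝒯, ⋃ T' ∈ 𝒯, {p | T ∩ T' = {p}}
  have hc := countable_tiles hs h
  have hD : D.Countable := by
    refine hc.biUnion fun T _ => hc.biUnion fun T' _ => Set.Subsingleton.countable ?_
    intro p hp q hq
    exact singleton_injective ((show T ∩ T' = {p} from hp).symm.trans hq)
  have hclosed (P : Set ℍ → Prop) : IsClosed (⋃ T : {T : 𝒯 // P T}, (T.1 : Set ℍ)) :=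
    ((locallyFinite_tiles hs h).comp_injective Subtype.val_injective).isClosed_iUnion
      fun T => (h.isTiling.isCompact _ T.1.2).isClosed
  have hne (P : Set ℍ → Prop) (T : Set ℍ) (hT : T ∈ 𝒯) (hP : P T) :
      (Dᶜ ∩ ⋃ T : {T : 𝒯 // P T}, (T.1 : Set ℍ)).Nonempty := by
    obtain ⟨g, rfl⟩ := h.isCopy T hT
    have h1 : ¬ g '' pentagon s ⊆ D := fun hsub => not_countable_tile hs g (hD.mono hsub)
    obtain ⟨p, hp, hpD⟩ := not_subset.1 h1
    exact ⟨p, hpD, mem_iUnion.2 ⟨⟨⟨_, hT⟩, hP⟩, hp⟩⟩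
  obtain ⟨p, hpD, hp1, hp2⟩ := isPreconnected_closed_iff.1 (isPreconnected_compl_of_countable hD)
    _ _ (hclosed good) (hclosed fun T => ¬ good T)
    (fun p _ => by
      obtain ⟨T, hT, hp⟩ := h.isTiling.covers.symm.subset (mem_univ p)
      by_cases hg : good T
      · exact Or.inl (mem_iUnion.2 ⟨⟨⟨T, hT⟩, hg⟩, hp⟩)
      · exact Or.inr (mem_iUnion.2 ⟨⟨⟨T, hT⟩, hg⟩, hp⟩))
    (hne good _ h₀ ⟨g₀, rfl, 1, 0, one_ne_zero, fun z => by simp⟩)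
    (hne (fun T => ¬ good T) T hT hbad)
  obtain ⟨T₁, hT₁, hg₁, hp1⟩ : ∃ T ∈ 𝒯, good T ∧ p ∈ T := by
    obtain ⟨T, hp⟩ := mem_iUnion.1 hp1
    exact ⟨_, T.1.2, T.2, hp⟩
  obtain ⟨T₂, hT₂, hg₂, hp2⟩ : ∃ T ∈ 𝒯, ¬ good T ∧ p ∈ T := by
    obtain ⟨T, hp⟩ := mem_iUnion.1 hp2
    exact ⟨_, T.1.2, T.2, hp⟩
  obtain ⟨g, rfl, hg⟩ := hg₁
  obtain ⟨g', rfl⟩ := h.isCopy _ hT₂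
  refine hg₂ ⟨g', rfl, ?_⟩
  have hne' : g '' pentagon s ≠ g' '' pentagon s := by
    intro he
    exact hg₂ ⟨g, he.symm, hg⟩
  rcases h.edgeToEdge _ hT₁ _ hT₂ hne' ⟨p, hp1, hp2⟩ with ⟨hE, hE'⟩ | ⟨q, hq, -⟩
  · have := hg.mul (isAff_of_common_edge hs h.orientation hT₁ hT₂ hE hE')
    simpa [mul_assoc] using this
  · refine (hpD ?_).elim
    have hpq : p = q := hq.subset ⟨hp1, hp2⟩
    subst hpq
    exact mem_biUnion hT₁ (mem_biUnion hT₂ hq)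

/-- Every symmetry of the tiling fixes the common ideal point of the tiles. -/
theorem isAff_of_mem_symmetryGroup {s : ℝ} (hs : 0 < s) {𝒯 : Set (Set ℍ)} (h : IsBTiling s 𝒯)
    {g₀ : ℍ ≃ᵢ ℍ} (h₀ : g₀ '' pentagon s ∈ 𝒯) {φ : ℍ ≃ᵢ ℍ} (hφ : φ ∈ symmetryGroup 𝒯) :
    IsAff (g₀⁻¹ * φ * g₀) := by
  have h1 : (fun T : Set ℍ => φ '' T) '' 𝒯 = 𝒯 := hφ
  obtain ⟨g, hg, hA⟩ := exists_isAff_of_mem hs h h₀ (h1.subset (mem_image_of_mem _ h₀))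
  have h2 : g '' pentagon s = (φ * g₀) '' pentagon s := by
    rw [IsometryEquiv.coe_mul, image_comp]
    exact hg.symm
  have := hA.mul (isAff_of_image_eq hs h2)
  simpa [mul_assoc] using this

/-! ### Groups fixing ∞ are not cocompact -/

/-- A group of isometries fixing `∞` whose translations are discrete is not cocompact. -/
theorem iUnion_image_ne_univ_of_isAff {H : Subgroup (ℍ ≃ᵢ ℍ)} (hA : ∀ η ∈ H, IsAff η) {δ : ℝ}
    (hδ : 0 < δ) (hdisc : ∀ η ∈ H, ∀ β : ℝ,
      (∀ z : ℍ, (η z).re = z.re + β ∧ (η z).im = z.im) → |β| < δ → β = 0)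
    {F : Set ℍ} (hF : IsCompact F) : ⋃ η ∈ H, η '' F ≠ univ := by
  intro hcov
  have hmem (z : ℍ) : ∃ η ∈ H, ∃ w ∈ F, η w = z := by
    simpa using hcov.symm.subset (mem_univ z)
  by_cases hα : ∃ φ ∈ H, ∃ α β : ℝ, 1 < |α| ∧
      ∀ z : ℍ, (φ z).re = α * z.re + β ∧ (φ z).im = |α| * z.im
  · obtain ⟨φ, hφ, α, β, hα, Hφ⟩ := hα
    have hα0 : α ≠ 0 := by rintro rfl; norm_num at hα
    have hα1 : 1 - α ≠ 0 := by
      intro h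
      rw [show α = 1 by linarith] at hα
      norm_num at hα
    -- Conjugation φ⁻ⁿηφⁿ divides the translation length by αⁿ.
    have htrans (n : ℕ) : ∀ η ∈ H, ∀ t : ℝ,
        (∀ z : ℍ, (η z).re = z.re + t ∧ (η z).im = z.im) →
        ∃ η' ∈ H, ∀ z : ℍ, (η' z).re = z.re + t / α ^ n ∧ (η' z).im = z.im := by
      induction n with
      | zero => intro η hη t ht; exact ⟨η, hη, by simpa using ht⟩
      | succ n ih =>
        intro η hη t ht
        obtain ⟨η', hη', ht'⟩ := ih η hη t ht
        refine ⟨φ⁻¹ * η' * φ, H.mul_mem (H.mul_mem (H.inv_mem hφ) hη') hφ, fun z => ?_⟩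
        obtain ⟨e1, e2⟩ := Hφ ((φ⁻¹ * η' * φ) z)
        have e0 : φ ((φ⁻¹ * η' * φ) z) = η' (φ z) := IsometryEquiv.apply_inv_self φ _
        rw [e0] at e1 e2
        rw [(ht' _).1, (Hφ z).1] at e1
        rw [(ht' _).2, (Hφ z).2] at e2
        constructor
        · apply mul_left_cancel₀ hα0
          rw [pow_succ]
          field_simp at e1 ⊢
          linarith
        · exact (mul_left_cancel₀ (abs_pos.2 hα0).ne' e2).symm
    have hzero (η : ℍ ≃ᵢ ℍ) (hη : η ∈ H) (t : ℝ)
        (ht : ∀ z : ℍ, (η z).re = z.re + t ∧ (η z).im = z.im) : t = 0 := by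
      obtain ⟨n, hn⟩ := pow_unbounded_of_one_lt (|t| / δ) hα
      obtain ⟨η', hη', ht'⟩ := htrans n η hη t ht
      have hpos : 0 < |α| ^ n := by positivity
      have := hdisc η' hη' _ ht' (by
        rw [abs_div, abs_pow, div_lt_iff₀ hpos]
        rw [div_lt_iff₀ hδ] at hn
        linarith)
      simpa [hα0] using this
    -- The commutator of η and φ has linear part 1, so it is a translation, hence trivial.
    have hcomm (η : ℍ ≃ᵢ ℍ) (hη : η ∈ H) (A B : ℝ)
        (hη' : ∀ z : ℍ, (η z).re = A * z.re + B ∧ (η z).im = |A| * z.im) :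
        A * β + B = α * B + β := by
      have h0 := hzero ((η * φ) * (φ * η)⁻¹)
        (H.mul_mem (H.mul_mem hη hφ) (H.inv_mem (H.mul_mem hφ hη))) (A * β + B - (α * B + β))
        fun z => by
          obtain ⟨w, rfl⟩ := (φ * η).surjective z
          rw [IsometryEquiv.mul_apply, IsometryEquiv.inv_apply_self, IsometryEquiv.mul_apply,
            IsometryEquiv.mul_apply, (hη' _).1, (hη' _).2, (Hφ _).1, (Hφ _).2, (Hφ _).1, (Hφ _).2,
            (hη' _).1, (hη' _).2]
          constructor <;> ring
      linarith
    -- The finite ideal fixed point of φ; commuting with φ, every η fixes it too. Then |Re z - x₀| /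
    -- Im z, the sinh of the distance to the line from x₀ to ∞, is invariant.
    set x₀ := β / (1 - α)
    have hx₀ : x₀ * (1 - α) = β := div_mul_cancel₀ _ hα1
    obtain ⟨C, hC⟩ := hF.exists_bound_of_continuousOn (f := fun z : ℍ => (z.re - x₀) / z.im)
      ((UpperHalfPlane.continuous_re.sub continuous_const).div UpperHalfPlane.continuous_im
        fun z => z.im_pos.ne').continuousOn
    obtain ⟨η, hη, w, hw, hwz⟩ := hmem (pt (x₀ + |C| + 1) 1 one_pos)
    obtain ⟨A, B, hA0, hη'⟩ := hA η hη
    have hB : B = x₀ * (1 - A) := by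
      apply mul_right_cancel₀ hα1
      have := hcomm η hη A B hη'
      rw [← hx₀] at this
      linarith
    have e1 := (hη' w).1
    have e2 := (hη' w).2
    rw [hwz, pt_re, hB] at e1
    rw [hwz, pt_im] at e2
    have h3 := hC w hw
    have hwpos := w.im_pos
    have h4 : |(w.re - x₀) / w.im| = |C| + 1 := by
      have e3 : A * (w.re - x₀) = |C| + 1 := by linarith
      have e4 := congrArg abs e3
      rw [abs_mul, abs_of_pos (by positivity : 0 < |C| + 1)] at e4
      rw [abs_div, abs_of_pos hwpos, ← e4, div_eq_iff hwpos.ne']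
      linear_combination |w.re - x₀| * e2
    rw [Real.norm_eq_abs, h4] at h3
    linarith [le_abs_self C]
  · push Not at hα
    have hone (η : ℍ ≃ᵢ ℍ) (hη : η ∈ H) (w : ℍ) : (η w).im ≤ w.im := by
      obtain ⟨A, B, hA0, hη'⟩ := hA η hη
      have h1 : |A| ≤ 1 := by
        by_contra! hlt
        obtain ⟨z, hz⟩ := hα η hη A B hlt
        exact hz (hη' z).1 (hη' z).2
      rw [(hη' w).2]
      exact mul_le_of_le_one_left w.im_pos.le h1
    obtain ⟨C, hC⟩ := hF.exists_bound_of_continuousOn UpperHalfPlane.continuous_im.continuousOn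
    obtain ⟨η, hη, w, hw, hwz⟩ := hmem (pt 0 (|C| + 1) (by positivity))
    have h1 := hone η hη w
    have h2 := hC w hw
    rw [hwz, pt_im] at h1
    rw [Real.norm_eq_abs] at h2
    linarith [le_abs_self C, le_abs_self w.im]

end Boroczky

/-! ### Discreteness of translations and conclusion -/

open Boroczky UpperHalfPlane in
theorem mainTheorem4 (s : ℝ) (hs : 0 < s) (𝒯 : Set (Set UpperHalfPlane))
    (h𝒯 : Boroczky.IsBTiling s 𝒯) : ¬ Boroczky.IsCrystallographic 𝒯 := by
  rintro ⟨F, hF, hdom⟩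
  obtain ⟨T, hT, -⟩ := h𝒯.isTiling.covers.symm.subset (mem_univ I)
  obtain ⟨g, rfl⟩ := h𝒯.isCopy T hT
  -- Conjugation by g moves the common ideal point to ∞.
  let H : Subgroup (ℍ ≃ᵢ ℍ) := (symmetryGroup 𝒯).comap (MulAut.conj g).toMonoidHom
  have hH (η : ℍ ≃ᵢ ℍ) : η ∈ H ↔ g * η * g⁻¹ ∈ symmetryGroup 𝒯 := Iff.rfl
  refine iUnion_image_ne_univ_of_isAff (H := H) (fun η hη => ?_) hs ?_
    (hF.image g⁻¹.continuous) ?_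
  · simpa [mul_assoc] using isAff_of_mem_symmetryGroup hs h𝒯 hT ((hH η).1 hη)
  · intro η hη β hβ hlt
    obtain ⟨h1, h2⟩ := abs_lt.1 hlt
    have hmem : (fun T : Set ℍ => (g * η * g⁻¹) '' T) '' 𝒯 = 𝒯 := (hH η).1 hη
    have hT' : g '' (η '' pentagon s) ∈ 𝒯 := by
      have := hmem.subset (mem_image_of_mem _ hT)
      simpa [image_image, IsometryEquiv.mul_apply] using this
    -- A translation by less than s, half the width of the pentagon, keeps its centre in the
    -- interior; the two tiles overlap and hence coincide.
    have him : η '' pentagon s = pentagon s := by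
      by_contra hne
      have hd := h𝒯.isTiling.disjoint _ hT' _ hT fun he => hne (g.injective.image_injective he)
      rw [← image_interior_eq g, ← image_interior_eq g, disjoint_image_iff g.injective,
        ← image_interior_eq] at hd
      refine disjoint_left.1 hd (mem_image_of_mem η (center_mem_interior hs)) ?_
      apply pentagon_open_subset_interior
      have := hβ (pt 0 (3 / 2) (by norm_num))
      simp only [pt_re, pt_im, zero_add] at this
      refine ⟨?_, ?_, ?_, ?_⟩
      · rw [this.1]; exact h1
      · rw [this.1]; exact h2
      · rw [this.2]; norm_num
      · rw [this.2]; norm_num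
    have hr : pt s 1 one_pos ∈ pentagon s := ⟨by simp; linarith, le_rfl, le_rfl, by simp⟩
    have hl : pt (-s) 1 one_pos ∈ pentagon s := ⟨le_rfl, by simp; linarith, le_rfl, by simp⟩
    have hr' := (him.subset (mem_image_of_mem η hr)).2.1
    have hl' := (him.subset (mem_image_of_mem η hl)).1
    rw [(hβ _).1, pt_re] at hr' hl'
    linarith
  · rw [eq_univ_iff_forall]
    intro z
    have hz := hdom.covers.symm.subset (mem_univ (g z))
    simp only [mem_iUnion, exists_prop] at hz ⊢
    obtain ⟨φ, hφ, w, hw, hwz⟩ := hz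
    refine ⟨g⁻¹ * φ * g, ?_, g⁻¹ w, mem_image_of_mem _ hw, ?_⟩
    · rw [hH]
      simpa [mul_assoc] using hφ
    · simp [IsometryEquiv.mul_apply, hwz]
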